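/- **Model.** A state of nature $\theta\in\{H,L\}$ is drawn with $\Pr(\theta=H)=\tfrac12$. Signals take values in $S=\{h,l\}$ and are i.i.d. conditional on $\theta$, with $\pi_H(h)=\pi_L(l)=q$ and $\pi_H(l)=\pi_L(h)=1-q$, where $q\in(\tfrac12,1)$. A receiver with $m$ memory states $M=\{1,\dots,m\}$ chooses a protocol $\Pi=(f,g,a)$: a transition function $f:M\times S\to\Delta(M)$, an initial distribution $g\in\Delta(M)$, and an action rule $a:M\to[0,1]$, where $a(i)$ is the probability of taking action $H$ in memory state $i$. The sender observes $\Pi$ and $\theta$ and chooses a strategy $\sigma:M\times\{H,L\}\to[0,1]$, where $\sigma(i,\theta)$ is the probability of stopping when the current memory state is $i$. The initial memory state $m_0$ is drawn from $g$. In each period $t=0,1,\dots$ the game ends if $m_t$ is absorbing (that is, $f(m_t,s)(m_t)=1$ for all $s\in S$) or if the sender stops; otherwise a signal $s_t\sim\pi_\theta$ is generated and $m_{t+1}\sim f(m_t,s_t)$. When the game ends in memory state $i$, action $H$ is taken with probability $a(i)$ and action $L$ otherwise. The sender gets $1$ if the action is $H$ and $0$ otherwise; the receiver gets $1$ if the action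 equals $\theta$ and $0$ otherwise; both get $0$ if the game never ends. Let $U^S(\Pi,\sigma)$ and $U^R(\Pi,\sigma)$ be the expected payoffs, and let $\mathrm{br}(\Pi)$ be the set of strategies $\sigma$ that maximize $U^S(\Pi,\cdot)$. Let $U^R(\Pi):=U^R(\Pi,\sigma)$ for any $\sigma\in\mathrm{br}(\Pi)$ under which the game ends with probability $1$. **Statement.** Let $m>2$ and $q\in(\tfrac12,1)$. Then $U^R(\Pi)$ is well defined for every protocol $\Pi$ with $m$ memory states (such a best response exists, and all of them give the receiver the same payoff), and $$\sup_{\Pi}U^R(\Pi)=\frac{q^{m-2}}{q^{m-2}+(1-q)^{m-2}},$$ where the supremum is over all protocols with $m$ memory states. -/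

import Mathlib

noncomputable section

namespace Persuasion

/-- The two states of nature. -/
inductive Nature
  | H
  | L

/-- The two signals of the binary case. -/
inductive Signal
  | h
  | l
  deriving DecidableEq

instance : Fintype Signal where
  elems := {Signal.h, Signal.l}
  complete := by intro s; cases s <;> simp

/-- The primitives: a prior `p ∈ (0,1)` on the state `H`, and for each state of nature a
full-support distribution on the finite signal set `S`, the two distributions being distinct. -/
structure Environment (S : Type) [Fintype S] where
  p : ℝ
  p_pos : 0 < p
  p_lt_one : p < 1
  signal : Nature → S → ℝ
  signal_pos : ∀ θ s, 0 < signal θ s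
  signal_sum : ∀ θ, ∑ s, signal θ s = 1
  signal_ne : signal Nature.H ≠ signal Nature.L

/-- A protocol (automaton) on the memory set `{1, …, m}`, modelled by `Fin m`:
a stochastic transition function, an initial distribution and an action rule
(`action i` is the probability of taking action `H` in memory state `i`). -/
structure Protocol (m : ℕ) (S : Type) where
  trans : Fin m → S → stdSimplex ℝ (Fin m)
  init : stdSimplex ℝ (Fin m)
  action : Fin m → unitInterval

/-- A sender strategy: the probability of stopping the signal process, as a function of the
current memory state and the state of nature. -/
abbrev Strategy (m : ℕ) : Type := Fin m → Nature → unitInterval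

variable {S : Type} {m : ℕ}

/-- The memory state `i` never changes again, whatever the signal. -/
def Protocol.IsAbsorbing (P : Protocol m S) (i : Fin m) : Prop :=
  ∀ s, (P.trans i s).1 i = 1

open Classical in
/-- The probability that the game ends in the current period, given that it is still running, that
the current memory state is `i` and that the state of nature is `θ`: it ends for sure in an
absorbing memory state, and otherwise exactly if the sender stops. -/
def endProb (P : Protocol m S) (σ : Strategy m) (θ : Nature) (i : Fin m) : ℝ :=
  if P.IsAbsorbing i then 1 else (σ i θ : ℝ)

theorem endProb_nonneg (P : Protocol m S) (σ : Strategy m) (θ : Nature) (i : Fin m) :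
    0 ≤ endProb P σ θ i := by
  unfold endProb
  split_ifs
  · exact zero_le_one
  · exact (σ i θ).2.1

theorem endProb_le_one (P : Protocol m S) (σ : Strategy m) (θ : Nature) (i : Fin m) :
    endProb P σ θ i ≤ 1 := by
  unfold endProb
  split_ifs
  · exact le_rfl
  · exact (σ i θ).2.2

variable [Fintype S]

/-- `running E P σ θ t i` is the probability, in the state of nature `θ`, that the game has not
ended before period `t` and that the memory state in period `t` is `i`. -/
def running (E : Environment S) (P : Protocol m S) (σ : Strategy m) (θ : Nature) :
    ℕ → Fin m → ℝ
  | 0, j => P.init.1 j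
  | t + 1, j => ∑ i, running E P σ θ t i * (1 - endProb P σ θ i) *
      ∑ s, E.signal θ s * (P.trans i s).1 j

/-- The probability, in the state of nature `θ`, that the game ends (in some period) in the
memory state `i`. -/
def endsIn (E : Environment S) (P : Protocol m S) (σ : Strategy m) (θ : Nature) (i : Fin m) : ℝ :=
  ∑' t, running E P σ θ t i * endProb P σ θ i

/-- The sender's expected payoff: `1` if the game ends with action `H`, and `0` otherwise. -/
def senderPayoff (E : Environment S) (P : Protocol m S) (σ : Strategy m) : ℝ :=
  E.p * ∑ i, endsIn E P σ Nature.H i * (P.action i : ℝ) +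
    (1 - E.p) * ∑ i, endsIn E P σ Nature.L i * (P.action i : ℝ)

/-- The receiver's expected payoff: `1` if the game ends with the action that matches the state of
nature, and `0` otherwise (also if the game never ends). -/
def receiverPayoff (E : Environment S) (P : Protocol m S) (σ : Strategy m) : ℝ :=
  E.p * ∑ i, endsIn E P σ Nature.H i * (P.action i : ℝ) +
    (1 - E.p) * ∑ i, endsIn E P σ Nature.L i * (1 - (P.action i : ℝ))

/-- The sender's best responses to the protocol `P`. -/
def bestResponses (E : Environment S) (P : Protocol m S) : Set (Strategy m) :=
  {σ | ∀ σ', senderPayoff E P σ' ≤ senderPayoff E P σ}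

/-- The game ends with probability one, in both states of nature. -/
def EndsAlmostSurely (E : Environment S) (P : Protocol m S) (σ : Strategy m) : Prop :=
  ∀ θ, ∑ i, endsIn E P σ θ i = 1

/-- `u` is the receiver's payoff `U^R(P)` from the protocol `P`: the payoff when the sender plays a
best response under which the game ends with probability one. -/
def IsReceiverValue (E : Environment S) (P : Protocol m S) (u : ℝ) : Prop :=
  ∃ σ ∈ bestResponses E P, EndsAlmostSurely E P σ ∧ receiverPayoff E P σ = u

/-- Signal distribution of the symmetric binary case: the signal is correct with probability
`q`. -/
def symmetricSignal (q : ℝ) : Nature → Signal → ℝ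
  | Nature.H, Signal.h => q
  | Nature.H, Signal.l => 1 - q
  | Nature.L, Signal.h => 1 - q
  | Nature.L, Signal.l => q

theorem Signal.sum_univ (f : Signal → ℝ) : ∑ s, f s = f Signal.h + f Signal.l := by
  have : (Finset.univ : Finset Signal) = {Signal.h, Signal.l} := rfl
  rw [this, Finset.sum_pair (by simp)]

/-- The symmetric binary case: prior `1/2`, and binary signals of accuracy `q ∈ (1/2, 1)`. -/
def symmetricBinary (q : ℝ) (hq : 1 / 2 < q) (hq' : q < 1) : Environment Signal where
  p := 1 / 2
  p_pos := by norm_num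
  p_lt_one := by norm_num
  signal := symmetricSignal q
  signal_pos := by
    intro θ s
    cases θ <;> cases s <;> simp only [symmetricSignal] <;> linarith
  signal_sum := by
    intro θ
    cases θ <;> rw [Signal.sum_univ] <;> simp only [symmetricSignal] <;> ring
  signal_ne := by
    intro h
    have := congrFun h Signal.h
    simp only [symmetricSignal] at this
    linarith

/-! The series in `endsIn` converges, and the ending probabilities sum to at most one. -/

theorem running_nonneg (E : Environment S) (P : Protocol m S) (σ : Strategy m) (θ : Nature)
    (t : ℕ) (i : Fin m) : 0 ≤ running E P σ θ t i := by
  induction t generalizing i with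
  | zero => exact P.init.2.1 i
  | succ t ih =>
    refine Finset.sum_nonneg fun j _ => mul_nonneg (mul_nonneg (ih j) ?_)
      (Finset.sum_nonneg fun s _ => mul_nonneg (E.signal_pos θ s).le ((P.trans j s).2.1 i))
    linarith [endProb_le_one P σ θ j]

theorem sum_ended_add_running (E : Environment S) (P : Protocol m S) (σ : Strategy m)
    (θ : Nature) (n : ℕ) :
    (∑ t ∈ Finset.range n, ∑ i, running E P σ θ t i * endProb P σ θ i) +
      ∑ i, running E P σ θ n i = 1 := by
  induction n with
  | zero => simpa [running] using P.init.2.2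
  | succ n ih =>
    have key : ∑ j, running E P σ θ (n + 1) j =
        ∑ i, running E P σ θ n i * (1 - endProb P σ θ i) := by
      simp only [running]
      rw [Finset.sum_comm]
      refine Finset.sum_congr rfl fun i _ => ?_
      rw [← Finset.mul_sum, Finset.sum_comm]
      have : ∀ s, ∑ j, E.signal θ s * (P.trans i s).1 j = E.signal θ s := fun s => by
        rw [← Finset.mul_sum, (P.trans i s).2.2, mul_one]
      rw [Finset.sum_congr rfl fun s _ => this s, E.signal_sum, mul_one]
    have hsplit : (∑ i, running E P σ θ n i * endProb P σ θ i) +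
        ∑ i, running E P σ θ n i * (1 - endProb P σ θ i) = ∑ i, running E P σ θ n i := by
      rw [← Finset.sum_add_distrib]
      exact Finset.sum_congr rfl fun i _ => by ring
    rw [Finset.sum_range_succ, key, add_assoc, hsplit, ih]

theorem summable_endsIn (E : Environment S) (P : Protocol m S) (σ : Strategy m) (θ : Nature)
    (i : Fin m) : Summable fun t => running E P σ θ t i * endProb P σ θ i := by
  have hn : ∀ t j, 0 ≤ running E P σ θ t j * endProb P σ θ j := fun t j =>
    mul_nonneg (running_nonneg E P σ θ t j) (endProb_nonneg P σ θ j)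
  refine summable_of_sum_range_le (c := 1) (fun t => hn t i) fun n => ?_
  have h1 := sum_ended_add_running E P σ θ n
  have h2 : 0 ≤ ∑ j, running E P σ θ n j :=
    Finset.sum_nonneg fun j _ => running_nonneg E P σ θ n j
  have h3 : ∑ t ∈ Finset.range n, running E P σ θ t i * endProb P σ θ i ≤
      ∑ t ∈ Finset.range n, ∑ j, running E P σ θ t j * endProb P σ θ j :=
    Finset.sum_le_sum fun t _ =>
      Finset.single_le_sum (f := fun j => running E P σ θ t j * endProb P σ θ j)
        (fun j _ => hn t j) (Finset.mem_univ i)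
  linarith

end Persuasion

end

/-! For a fixed protocol the sender faces, in each state of nature, an optimal stopping problem for
a finite Markov chain with reward `action`. Its value `v θ` is the least superharmonic majorant of
the reward, and stopping where the two agree is optimal and ends the game almost surely. With prior
1/2 the receiver therefore gets 1/2 plus half the expected difference `v H - v L` under the initial
distribution (`isReceiverValue_iff`).

Upper bound: let `D` be the optimal stopping set in `H`, and let the sender use `D` in `L` as well,
which can only underestimate `v L`. By Cramer's rule the probabilities of ending with action `H` and
with action `L` have a common denominator, and their numerators are multilinear in the rows of
transition rates and monotone on nonnegative rows. The two kernels differ entrywise by a factor of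
at most `r = q / (1 - q)`, so the odds differ by at most `r ^ (2 * |Dᶜ|)` (`exit_odds_le`). If `D`
is a single state, the two probabilities coincide; otherwise `|Dᶜ| ≤ m - 2`. Probabilities whose
odds ratio is at most `Λ ^ 2` differ by at most `(Λ - 1) / (Λ + 1)` (`sub_le_of_odds_le`), which is
the bound with `Λ = r ^ (m - 2)`.

Lower bound: a walk on the `m - 2` interior states that leaves them at either end only with
probability `δ` per suitable signal. Its exit probabilities are explicit (`walkScale_harmonic`), and
they reach the bound as `δ → 0`. -/

/-! ### A nonnegative multilinear determinant -/

namespace Persuasion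

open Filter Topology Matrix

section ExitNumerator

variable {ι : Type*} [Fintype ι] [DecidableEq ι]

/-- The linear system for the exit probabilities of a transient chain: row `k` of `d` lists the
rates from `k` to the states in `ι`, to the exit `true` and to the exit `false`. -/
def exitMatrix (d : ι → ι ⊕ Bool → ℝ) : Matrix ι ι ℝ :=
  fun k j => (if j = k then ∑ c, d k c else 0) - d k (Sum.inl j)

/-- Cramer's numerator for the probability of leaving from `i` through the exit `true`. -/
def exitNum (d : ι → ι ⊕ Bool → ℝ) (i : ι) : ℝ :=
  cramer (exitMatrix d) (fun k => d k (Sum.inr true)) i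

/-- `exitNum` as a multilinear function of the rows of rates. -/
def exitNumMultilinear (i : ι) : MultilinearMap ℝ (fun _ : ι => ι ⊕ Bool → ℝ) ℝ :=
  (detRowAlternating (R := ℝ) (n := ι)).toMultilinearMap.compLinearMap fun k =>
    -- Because the diagonal carries the row total instead of `1`, row `k` of the Cramer matrix is
    -- linear in row `k` of the rates and involves no other row.
    { toFun := fun v j =>
        if j = i then v (Sum.inr true) else (if j = k then ∑ c, v c else 0) - v (Sum.inl j)
      map_add' := fun v w => by
        ext j
        simp only [Pi.add_apply, Finset.sum_add_distrib]
        split_ifs <;> ring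
      map_smul' := fun r v => by
        ext j
        simp only [Pi.smul_apply, smul_eq_mul, ← Finset.mul_sum, RingHom.id_apply]
        split_ifs <;> ring }

theorem exitNumMultilinear_apply (d : ι → ι ⊕ Bool → ℝ) (i : ι) :
    exitNumMultilinear i d = exitNum d i := by
  rw [exitNum, cramer_apply]
  change Matrix.det _ = Matrix.det _
  congr 1
  ext k j
  simp only [updateCol_apply]
  rfl

/-- Scaling the internal rates by `s ∈ [0, 1]` keeps the matrix strictly diagonally dominant, hence
nonsingular. At `s = 0` it is diagonal with positive entries, so the determinant cannot change sign
on the way to `s = 1`. -/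
theorem det_exitMatrix_pos (d : ι → ι ⊕ Bool → ℝ) (hd : ∀ k c, 0 ≤ d k c)
    (hpos : ∀ k, 0 < d k (Sum.inr false)) : 0 < (exitMatrix d).det := by
  let A : ℝ → Matrix ι ι ℝ := fun s k j => (if j = k then ∑ c, d k c else 0) - s * d k (Sum.inl j)
  have hrow : ∀ k, ∑ j, d k (Sum.inl j) < ∑ c, d k c := fun k => by
    rw [Fintype.sum_sum_type, Fintype.sum_bool]
    linarith [hd k (Sum.inr true), hpos k]
  have hne : ∀ s ∈ Set.Icc (0 : ℝ) 1, (A s).det ≠ 0 := fun s hs => by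
    refine det_ne_zero_of_sum_row_lt_diag fun k => ?_
    have h1 : ∑ j ∈ Finset.univ.erase k, ‖A s k j‖ =
        ∑ j ∈ Finset.univ.erase k, s * d k (Sum.inl j) := by
      refine Finset.sum_congr rfl fun j hj => ?_
      simp only [A, if_neg (Finset.ne_of_mem_erase hj), zero_sub, norm_neg]
      exact Real.norm_of_nonneg (mul_nonneg hs.1 (hd _ _))
    have h2 : ∑ j ∈ Finset.univ.erase k, s * d k (Sum.inl j) =
        s * (∑ j, d k (Sum.inl j)) - s * d k (Sum.inl k) := by
      rw [Finset.mul_sum, ← Finset.add_sum_erase _ _ (Finset.mem_univ k)]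
      ring
    have h3 : s * (∑ j, d k (Sum.inl j)) ≤ ∑ j, d k (Sum.inl j) :=
      mul_le_of_le_one_left (Finset.sum_nonneg fun j _ => hd _ _) hs.2
    rw [h1, h2]
    refine lt_of_lt_of_le ?_ (le_abs_self _)
    simp only [A, if_true]
    linarith [hrow k]
  have hcont : Continuous fun s => (A s).det := by
    refine Continuous.matrix_det (continuous_pi fun k => continuous_pi fun j => ?_)
    simp only [A]
    fun_prop
  have h0 : 0 < (A 0).det := by
    have : A 0 = diagonal fun k => ∑ c, d k c := by
      ext k j
      by_cases h : j = k
      · subst h; simp [A]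
      · simp [A, h, diagonal_apply_ne' _ h]
    rw [this, det_diagonal]
    exact Finset.prod_pos fun k _ =>
      lt_of_le_of_lt (Finset.sum_nonneg fun j _ => hd _ _) (hrow k)
  have hA1 : A 1 = exitMatrix d := by ext k j; simp [A, exitMatrix]
  rw [← hA1]
  by_contra hneg
  obtain ⟨s, hs, hs0⟩ := intermediate_value_Icc' zero_le_one hcont.continuousOn
    ⟨not_lt.mp hneg, h0.le⟩
  exact hne s hs hs0

theorem exitMatrix_mulVec (d : ι → ι ⊕ Bool → ℝ) (y : ι → ℝ) (k : ι) :
    (exitMatrix d *ᵥ y) k = (∑ c, d k c) * y k - ∑ j, d k (Sum.inl j) * y j := by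
  simp [mulVec, dotProduct, exitMatrix, sub_mul, Finset.sum_sub_distrib, ite_mul]

/-- A minimum principle: at the state with the least numerator, a negative value would contradict
that state's equation, since the exit rates there are positive in total and the right-hand side is
nonnegative. -/
theorem exitNum_nonneg_of_pos (d : ι → ι ⊕ Bool → ℝ) (hd : ∀ k c, 0 ≤ d k c)
    (hpos : ∀ k, 0 < d k (Sum.inr false)) (i : ι) : 0 ≤ exitNum d i := by
  obtain ⟨k, -, hk⟩ := Finset.exists_min_image Finset.univ (exitNum d) ⟨i, Finset.mem_univ i⟩
  refine le_trans ?_ (hk i (Finset.mem_univ i))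
  by_contra! hneg
  have h1 : (exitMatrix d *ᵥ exitNum d) k = (exitMatrix d).det * d k (Sum.inr true) :=
    congrFun (mulVec_cramer (exitMatrix d) fun k => d k (Sum.inr true)) k
  have h2 : 0 ≤ (exitMatrix d).det * d k (Sum.inr true) :=
    mul_nonneg (det_exitMatrix_pos d hd hpos).le (hd _ _)
  have h3 : (∑ j, d k (Sum.inl j)) * exitNum d k ≤ ∑ j, d k (Sum.inl j) * exitNum d j := by
    rw [Finset.sum_mul]
    exact Finset.sum_le_sum fun j _ =>
      mul_le_mul_of_nonneg_left (hk j (Finset.mem_univ j)) (hd _ _)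
  rw [exitMatrix_mulVec, Fintype.sum_sum_type, Fintype.sum_bool] at h1
  have h4 : (d k (Sum.inr true) + d k (Sum.inr false)) * exitNum d k < 0 :=
    mul_neg_of_pos_of_neg (by linarith [hd k (Sum.inr true), hpos k]) hneg
  linarith

/-- Add `ε` to every rate of the exit `false` and let `ε → 0`. Degenerate rates must be covered
because the multilinear expansion in `exitNum_mono` mixes rows arbitrarily. -/
theorem exitNum_nonneg (d : ι → ι ⊕ Bool → ℝ) (hd : ∀ k c, 0 ≤ d k c) (i : ι) :
    0 ≤ exitNum d i := by
  let e : ℝ → ι → ι ⊕ Bool → ℝ := fun ε k c => d k c + ε * if c = Sum.inr false then 1 else 0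
  have hcont : Continuous fun ε => exitNum (e ε) i := by
    simp only [exitNum, cramer_apply]
    refine Continuous.matrix_det (continuous_pi fun k => continuous_pi fun j => ?_)
    simp only [updateCol_apply, exitMatrix, e]
    split_ifs <;> fun_prop
  have hlim : Tendsto (fun ε => exitNum (e ε) i) (𝓝[>] 0) (𝓝 (exitNum d i)) := by
    have h0 : e 0 = d := by ext k c; simp [e]
    have := (hcont.tendsto 0).mono_left (nhdsWithin_le_nhds (s := Set.Ioi 0))
    rwa [h0] at this
  refine ge_of_tendsto hlim (eventually_nhdsWithin_of_forall fun ε hε => ?_)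
  refine exitNum_nonneg_of_pos _ (fun k c => ?_) (fun k => ?_) i
  · simp only [e]
    split_ifs
    · rw [mul_one]; exact add_nonneg (hd k c) (le_of_lt hε)
    · simpa using hd k c
  · simpa [e] using add_pos_of_nonneg_of_pos (hd k (Sum.inr false)) hε

/-- Expand `e = d + (e - d)` multilinearly: each term is the numerator of a nonnegative system, and
one of them is `exitNum d i`. -/
theorem exitNum_mono (d e : ι → ι ⊕ Bool → ℝ) (hd : ∀ k c, 0 ≤ d k c)
    (hde : ∀ k c, d k c ≤ e k c) (i : ι) : exitNum d i ≤ exitNum e i := by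
  have h := (exitNumMultilinear i).map_add_univ d (e - d)
  rw [add_sub_cancel, exitNumMultilinear_apply] at h
  rw [h, ← exitNumMultilinear_apply]
  have h1 : exitNumMultilinear i d =
      exitNumMultilinear i ((Finset.univ : Finset ι).piecewise d (e - d)) := by
    rw [Finset.piecewise_univ]
  rw [h1]
  refine Finset.single_le_sum (f := fun s : Finset ι => exitNumMultilinear i (s.piecewise d (e - d)))
    (fun s _ => ?_) (Finset.mem_univ _)
  rw [exitNumMultilinear_apply]
  refine exitNum_nonneg _ (fun k c => ?_) i
  by_cases hk : k ∈ s
  · rw [Finset.piecewise_eq_of_mem _ _ _ hk]; exact hd k c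
  · rw [Finset.piecewise_eq_of_notMem _ _ _ hk]; exact sub_nonneg.mpr (hde k c)

theorem exitNum_le_prod_mul (d e : ι → ι ⊕ Bool → ℝ) (r : ι → ℝ) (hd : ∀ k c, 0 ≤ d k c)
    (hde : ∀ k c, d k c ≤ r k * e k c) (i : ι) : exitNum d i ≤ (∏ k, r k) * exitNum e i := by
  have h := (exitNumMultilinear i).map_smul_univ r e
  rw [exitNumMultilinear_apply, exitNumMultilinear_apply, smul_eq_mul] at h
  rw [← h]
  exact exitNum_mono _ _ hd hde i

end ExitNumerator

end Persuasion

/-! ### Optimal stopping of a finite Markov chain -/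

namespace Persuasion

open Filter Topology Matrix

section OptimalStopping

variable {ι : Type*}

/-- Every nonempty set that is closed under the transitions `K` meets `D`. -/
def MeetsClosed (K : ι → ι → ℝ) (D : Set ι) : Prop :=
  ∀ C : Set ι, C.Nonempty → (∀ i ∈ C, ∀ j, 0 < K i j → j ∈ C) → (C ∩ D).Nonempty

theorem MeetsClosed.mono {K K' : ι → ι → ℝ} {D : Set ι} (hD : MeetsClosed K D)
    (h : ∀ i j, 0 < K i j → 0 < K' i j) : MeetsClosed K' D :=
  fun C hC hcl => hD C hC fun i hi j hj => hcl i hi j (h i j hj)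

variable [Fintype ι]

/-- `K` is a stochastic matrix. -/
def IsTransition (K : ι → ι → ℝ) : Prop :=
  (∀ i j, 0 ≤ K i j) ∧ ∀ i, ∑ j, K i j = 1

/-- `v` is the least superharmonic majorant of `a`: the value of stopping the chain optimally. -/
structure IsStoppingValue (K : ι → ι → ℝ) (a v : ι → ℝ) : Prop where
  le : ∀ i, a i ≤ v i
  superharmonic : ∀ i, ∑ j, K i j * v j ≤ v i
  least : ∀ w : ι → ℝ, (∀ i, a i ≤ w i) → (∀ i, ∑ j, K i j * w j ≤ w i) → ∀ i, v i ≤ w i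

/-- If the minimum were negative, all minimizers would lie outside `D`. There the average is at most
the minimum, so every successor is again a minimizer; the minimizers form a closed set missing `D`.
-/
theorem minimum_principle {K : ι → ι → ℝ} (hK : IsTransition K) {D : Set ι}
    (hD : MeetsClosed K D) {y : ι → ℝ} (h0 : ∀ i ∈ D, 0 ≤ y i)
    (h1 : ∀ i ∉ D, ∑ j, K i j * y j ≤ y i) (i : ι) : 0 ≤ y i := by
  obtain ⟨k, -, hk⟩ := Finset.exists_min_image Finset.univ y ⟨i, Finset.mem_univ i⟩
  refine le_trans ?_ (hk i (Finset.mem_univ i))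
  by_contra! hneg
  obtain ⟨l, hl, hlD⟩ := hD {l | y l = y k} ⟨k, rfl⟩ fun l hl j hj => by
    have hl' : y l = y k := hl
    have hlD : l ∉ D := fun h => absurd (h0 l h) (by rw [hl']; exact not_le.mpr hneg)
    have hterm : ∀ j ∈ Finset.univ, 0 ≤ K l j * (y j - y k) := fun j hj =>
      mul_nonneg (hK.1 l j) (sub_nonneg.mpr (hk j hj))
    have hsum : ∑ j, K l j * (y j - y k) = ∑ j, K l j * y j - y k := by
      simp only [mul_sub, Finset.sum_sub_distrib, ← Finset.sum_mul, hK.2, one_mul]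
    have hle : ∑ j, K l j * (y j - y k) ≤ 0 := by rw [hsum, ← hl']; linarith [h1 l hlD]
    have hz := (Finset.sum_eq_zero_iff_of_nonneg hterm).mp
      (le_antisymm hle (Finset.sum_nonneg hterm)) j (Finset.mem_univ j)
    rcases mul_eq_zero.mp hz with h | h
    · exact absurd h hj.ne'
    · exact sub_eq_zero.mp h
  have h := h0 l hlD
  rw [show y l = y k from hl] at h
  linarith

theorem eq_zero_of_harmonic {K : ι → ι → ℝ} (hK : IsTransition K) {D : Set ι}
    (hD : MeetsClosed K D) {y : ι → ℝ} (h0 : ∀ i ∈ D, y i = 0)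
    (h1 : ∀ i ∉ D, y i = ∑ j, K i j * y j) (i : ι) : y i = 0 := by
  refine le_antisymm ?_ (minimum_principle hK hD (fun i hi => (h0 i hi).ge)
    (fun i hi => (h1 i hi).ge) i)
  have := minimum_principle hK hD (y := fun i => -y i) (fun i hi => by simp [h0 i hi])
    (fun i hi => by simp only [mul_neg, Finset.sum_neg_distrib]; exact neg_le_neg (h1 i hi).le) i
  linarith

/-- The pointwise infimum of superharmonic majorants is one itself; the constant `1` shows that
there are any. -/
theorem exists_isStoppingValue {K : ι → ι → ℝ} (hK : IsTransition K) {a : ι → ℝ}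
    (ha : ∀ i, a i ≤ 1) : ∃ v, IsStoppingValue K a v := by
  let W : Set (ι → ℝ) := {w | (∀ i, a i ≤ w i) ∧ ∀ i, ∑ j, K i j * w j ≤ w i}
  have hone : (fun _ => 1 : ι → ℝ) ∈ W := ⟨ha, fun i => by simp [hK.2]⟩
  have : Nonempty W := ⟨⟨_, hone⟩⟩
  have hbdd : ∀ i, BddBelow (Set.range fun w : W => w.1 i) := fun i =>
    ⟨a i, by rintro _ ⟨w, rfl⟩; exact w.2.1 i⟩
  refine ⟨fun i => ⨅ w : W, w.1 i, fun i => le_ciInf fun w => w.2.1 i, fun i => ?_,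
    fun w h1 h2 i => ciInf_le (hbdd i) ⟨w, h1, h2⟩⟩
  refine le_ciInf fun w => le_trans (Finset.sum_le_sum fun j _ => ?_) (w.2.2 i)
  exact mul_le_mul_of_nonneg_left (ciInf_le (hbdd j) w) (hK.1 i j)

namespace IsStoppingValue

variable {K : ι → ι → ℝ} {a v : ι → ℝ}

theorem le_one (hv : IsStoppingValue K a v) (hK : IsTransition K) (ha : ∀ i, a i ≤ 1) (i : ι) :
    v i ≤ 1 :=
  hv.least (fun _ => 1) ha (fun i => by simp [hK.2]) i

/-- Otherwise `v` could be lowered at `i` alone and remain a superharmonic majorant. -/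
theorem eq_sum_of_ne (hv : IsStoppingValue K a v) (hK : IsTransition K) {i : ι} (hi : v i ≠ a i) :
    v i = ∑ j, K i j * v j := by
  classical
  refine le_antisymm ?_ (hv.superharmonic i)
  by_contra! hlt
  let w := Function.update v i (max (a i) (∑ j, K i j * v j))
  have hwv : ∀ j, w j ≤ v j := fun j => by
    by_cases h : j = i
    · subst h; simpa [w] using ⟨hv.le j, hlt.le⟩
    · simp [w, h]
  have hsum : ∀ k, ∑ j, K k j * w j ≤ ∑ j, K k j * v j := fun k =>
    Finset.sum_le_sum fun j _ => mul_le_mul_of_nonneg_left (hwv j) (hK.1 k j)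
  have h := hv.least w (fun j => ?_) (fun j => ?_) i
  · simp only [w, Function.update_self] at h
    rcases le_max_iff.mp h with h | h
    · exact hi (le_antisymm h (hv.le i))
    · linarith
  · by_cases h : j = i
    · subst h; simp [w]
    · simpa [w, h] using hv.le j
  · refine (hsum j).trans ?_
    by_cases h : j = i
    · subst h; simp [w]
    · simpa [w, h] using hv.superharmonic j

/-- On a closed set where `v > a` throughout, `v` could be lowered by the constant `ε = min (v -
a)`. This is what makes optimal stopping end almost surely. -/
theorem meetsClosed (hv : IsStoppingValue K a v) (hK : IsTransition K) :
    MeetsClosed K {i | v i = a i} := by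
  classical
  intro C hC hcl
  by_contra hempty
  have hpos : ∀ i ∈ C, 0 < v i - a i := fun i hi =>
    sub_pos.mpr (lt_of_le_of_ne (hv.le i) fun h => hempty ⟨i, hi, h.symm⟩)
  obtain ⟨k, hkC, hk⟩ := Set.exists_min_image C (fun i => v i - a i) (Set.toFinite C) hC
  let ε := v k - a k
  have hε : 0 < ε := hpos k hkC
  let w : ι → ℝ := fun i => v i - if i ∈ C then ε else 0
  have hsum : ∀ i, ∑ j, K i j * w j = ∑ j, K i j * v j - ∑ j, K i j * if j ∈ C then ε else 0 :=
    fun i => by simp only [w, mul_sub, Finset.sum_sub_distrib]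
  have h := hv.least w (fun i => ?_) (fun i => ?_) k
  · simp only [w, if_pos hkC] at h
    linarith
  · by_cases hi : i ∈ C
    · simp only [w, if_pos hi]
      linarith [hk i hi]
    · simpa [w, hi] using hv.le i
  · rw [hsum]
    by_cases hi : i ∈ C
    · have : ∑ j, K i j * (if j ∈ C then ε else 0) = ε := by
        rw [Finset.sum_congr rfl fun j _ => show K i j * (if j ∈ C then ε else 0) = K i j * ε from ?_,
          ← Finset.sum_mul, hK.2, one_mul]
        by_cases hj : j ∈ C
        · rw [if_pos hj]
        · have : K i j = 0 := le_antisymm (not_lt.mp fun h => hj (hcl i hi j h)) (hK.1 i j)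
          rw [this, zero_mul, zero_mul]
      rw [this]
      simp only [w, if_pos hi]
      linarith [hv.superharmonic i]
    · simp only [w, if_neg hi, sub_zero]
      have : 0 ≤ ∑ j, K i j * (if j ∈ C then ε else 0) := Finset.sum_nonneg fun j _ =>
        mul_nonneg (hK.1 i j) (by split_ifs; exacts [hε.le, le_rfl])
      linarith [hv.superharmonic i]

end IsStoppingValue

/-! ### How much more likely an exit can be in one chain than in another -/

open Classical in
/-- The rates of the chain `K` that is stopped in `D`, where it leaves from `i` through the exit
`true` with probability `a i`. -/
noncomputable def stoppedRates (K : ι → ι → ℝ) (D : Set ι) (a : ι → ℝ) (k : ι) : ι ⊕ Bool → ℝ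
  | Sum.inl j => if k ∈ D then 0 else K k j
  | Sum.inr true => if k ∈ D then a k else 0
  | Sum.inr false => if k ∈ D then 1 - a k else 0

theorem sum_stoppedRates {K : ι → ι → ℝ} (hK : IsTransition K) (D : Set ι) (a : ι → ℝ) (k : ι) :
    ∑ c, stoppedRates K D a k c = 1 := by
  rw [Fintype.sum_sum_type, Fintype.sum_bool]
  by_cases hk : k ∈ D <;> simp [stoppedRates, hk, hK.2]

theorem stoppedRates_nonneg {K : ι → ι → ℝ} (hK : IsTransition K) (D : Set ι) {a : ι → ℝ}
    (ha0 : ∀ i, 0 ≤ a i) (ha1 : ∀ i, a i ≤ 1) (k : ι) (c : ι ⊕ Bool) :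
    0 ≤ stoppedRates K D a k c := by
  rcases c with j | b | b <;> by_cases hk : k ∈ D <;>
    simp [stoppedRates, hk, hK.1, ha0, ha1]

variable [DecidableEq ι]

theorem exitMatrix_stoppedRates_mulVec {K : ι → ι → ℝ} (hK : IsTransition K) (D : Set ι)
    (a y : ι → ℝ) (k : ι) [Decidable (k ∈ D)] :
    (exitMatrix (stoppedRates K D a) *ᵥ y) k =
      y k - if k ∈ D then 0 else ∑ j, K k j * y j := by
  rw [exitMatrix_mulVec, sum_stoppedRates hK, one_mul]
  by_cases hk : k ∈ D <;> simp [stoppedRates, hk]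

theorem exitMatrix_stoppedRates_congr {K : ι → ι → ℝ} (hK : IsTransition K) (D : Set ι)
    (a b : ι → ℝ) : exitMatrix (stoppedRates K D a) = exitMatrix (stoppedRates K D b) := by
  ext k j
  simp only [exitMatrix, sum_stoppedRates hK]
  rfl

/-- Cramer's rule in adjugate form, so that no invertibility is needed. The determinant does not
depend on the reward, hence the free `b`: rewards `a` and `1 - a` share a denominator. -/
theorem exitNum_stoppedRates {K : ι → ι → ℝ} (hK : IsTransition K) (D : Set ι) (a b : ι → ℝ)
    {x : ι → ℝ} (h0 : ∀ i ∈ D, x i = a i) (h1 : ∀ i ∉ D, x i = ∑ j, K i j * x j) (i : ι) :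
    exitNum (stoppedRates K D a) i = (exitMatrix (stoppedRates K D b)).det * x i := by
  classical
  have hx : exitMatrix (stoppedRates K D a) *ᵥ x =
      fun k => stoppedRates K D a k (Sum.inr true) := by
    ext k
    rw [exitMatrix_stoppedRates_mulVec hK]
    by_cases hk : k ∈ D
    · simp [stoppedRates, hk, h0]
    · simp [stoppedRates, hk, ← h1 k hk]
  rw [exitNum, ← hx, cramer_eq_adjugate_mulVec, mulVec_mulVec, adjugate_mul, smul_mulVec,
    one_mulVec, exitMatrix_stoppedRates_congr hK D a b]
  rfl

theorem det_stoppedRates_ne_zero {K : ι → ι → ℝ} (hK : IsTransition K) {D : Set ι}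
    (hD : MeetsClosed K D) (a : ι → ℝ) : (exitMatrix (stoppedRates K D a)).det ≠ 0 := by
  classical
  intro hdet
  obtain ⟨y, hy, hy0⟩ := exists_mulVec_eq_zero_iff.mpr hdet
  have h : ∀ k, (y k - if k ∈ D then 0 else ∑ j, K k j * y j) = 0 := fun k => by
    rw [← exitMatrix_stoppedRates_mulVec hK D a, hy0]; rfl
  refine hy (funext fun i => eq_zero_of_harmonic hK hD (fun i hi => ?_) (fun i hi => ?_) i)
  · simpa [hi] using h i
  · have := h i
    rw [if_neg hi] at this
    linarith

/-- For the reward `1` the solution is the constant `1`, so the determinant equals a numerator,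
which is nonnegative. -/
theorem det_stoppedRates_pos {K : ι → ι → ℝ} (hK : IsTransition K) {D : Set ι}
    (hD : MeetsClosed K D) (a : ι → ℝ) (i : ι) :
    0 < (exitMatrix (stoppedRates K D a)).det := by
  refine lt_of_le_of_ne ?_ (det_stoppedRates_ne_zero hK hD a).symm
  have h := exitNum_stoppedRates hK D (fun _ => 1) a (x := fun _ => 1) (fun _ _ => rfl)
    (fun i _ => by simp [hK.2]) i
  rw [mul_one] at h
  rw [← h]
  exact exitNum_nonneg _ (stoppedRates_nonneg hK D (fun _ => zero_le_one) fun _ => le_rfl) i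

theorem exists_harmonic {K : ι → ι → ℝ} (hK : IsTransition K) {D : Set ι}
    (hD : MeetsClosed K D) (a : ι → ℝ) :
    ∃ x : ι → ℝ, (∀ i ∈ D, x i = a i) ∧ ∀ i ∉ D, x i = ∑ j, K i j * x j := by
  classical
  have hu : IsUnit (exitMatrix (stoppedRates K D a)) :=
    (isUnit_iff_isUnit_det _).mpr (det_stoppedRates_ne_zero hK hD a).isUnit
  obtain ⟨x, hx⟩ := (mulVec_surjective_iff_isUnit.mpr hu)
    fun k => stoppedRates K D a k (Sum.inr true)
  have h := fun k => exitMatrix_stoppedRates_mulVec hK D a x k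
  simp only [hx] at h
  refine ⟨x, fun i hi => ?_, fun i hi => ?_⟩
  · simpa [stoppedRates, hi] using (h i).symm
  · have := h i
    simp only [stoppedRates, if_neg hi] at this
    linarith

/-- Rows in `D` are the same for both chains, so only the transient rows cost a factor `r`. -/
theorem exitNum_stoppedRates_le {K K' : ι → ι → ℝ} (hK : IsTransition K) {D : Set ι}
    {r : ℝ} (hr : ∀ i j, K i j ≤ r * K' i j) {a : ι → ℝ}
    (ha0 : ∀ i, 0 ≤ a i) (ha1 : ∀ i, a i ≤ 1) (i : ι) :
    exitNum (stoppedRates K D a) i ≤ r ^ Dᶜ.ncard * exitNum (stoppedRates K' D a) i := by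
  classical
  have h := exitNum_le_prod_mul (stoppedRates K D a) (stoppedRates K' D a)
    (fun k => if k ∈ D then 1 else r) (stoppedRates_nonneg hK D ha0 ha1) (fun k c => ?_) i
  · rwa [Finset.prod_ite, Finset.prod_const_one, one_mul, Finset.prod_const,
      show (Finset.univ.filter fun k => k ∉ D).card = Dᶜ.ncard by
        rw [← Set.ncard_coe_finset]; congr 1; ext k; simp] at h
  · rcases c with j | b | b <;> by_cases hk : k ∈ D <;> simp [stoppedRates, hk, hr]

/-- Two chains whose transition probabilities differ at most by the factor `r` have odds of
leaving through an exit that differ at most by the factor `r ^ 2` per transient state. -/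
theorem exit_odds_le {K K' : ι → ι → ℝ} (hK : IsTransition K) (hK' : IsTransition K') {D : Set ι}
    (hD : MeetsClosed K D) (hD' : MeetsClosed K' D) {r : ℝ} (hr0 : 0 ≤ r)
    (hr : ∀ i j, K i j ≤ r * K' i j) (hr' : ∀ i j, K' i j ≤ r * K i j) {a x x' : ι → ℝ}
    (ha0 : ∀ i, 0 ≤ a i) (ha1 : ∀ i, a i ≤ 1)
    (h0 : ∀ i ∈ D, x i = a i) (h1 : ∀ i ∉ D, x i = ∑ j, K i j * x j)
    (h0' : ∀ i ∈ D, x' i = a i) (h1' : ∀ i ∉ D, x' i = ∑ j, K' i j * x' j) (i : ι) :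
    x i * (1 - x' i) ≤ (r ^ Dᶜ.ncard) ^ 2 * (x' i * (1 - x i)) := by
  have hb0 : ∀ i, 0 ≤ 1 - a i := fun i => sub_nonneg.mpr (ha1 i)
  have hb1 : ∀ i, 1 - a i ≤ 1 := fun i => by linarith [ha0 i]
  have compl : ∀ {L : ι → ι → ℝ}, IsTransition L → ∀ {y : ι → ℝ}, (∀ i ∈ D, y i = a i) →
      (∀ i ∉ D, y i = ∑ j, L i j * y j) → exitNum (stoppedRates L D fun i => 1 - a i) i =
        (exitMatrix (stoppedRates L D a)).det * (1 - y i) := fun {L} hL {y} hy0 hy1 =>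
    exitNum_stoppedRates hL D (fun i => 1 - a i) a (x := fun i => 1 - y i)
      (fun i hi => by simp only [hy0 i hi])
      (fun i hi => by
        simp only [mul_sub, mul_one, Finset.sum_sub_distrib, hL.2, ← hy1 i hi]) i
  -- Compare the `H` exit from `K` to `K'` and the `L` exit from `K'` to `K`. In the product of the
  -- two inequalities both sides carry both determinants, which cancel.
  have e1 := exitNum_stoppedRates_le hK (D := D) hr ha0 ha1 i
  have e2 := exitNum_stoppedRates_le hK' (D := D) hr' hb0 hb1 i
  have p2 := exitNum_nonneg _ (stoppedRates_nonneg hK' D hb0 hb1) i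
  have p1 := exitNum_nonneg _ (stoppedRates_nonneg hK' D ha0 ha1) i
  have h := mul_le_mul e1 e2 p2 (mul_nonneg (pow_nonneg hr0 _) p1)
  rw [exitNum_stoppedRates hK D a a h0 h1, exitNum_stoppedRates hK' D a a h0' h1',
    compl hK h0 h1, compl hK' h0' h1'] at h
  have d1 := det_stoppedRates_pos hK hD a i
  have d2 := det_stoppedRates_pos hK' hD' a i
  refine le_of_mul_le_mul_left ?_ (mul_pos d1 d2)
  linarith

/-- With `p = √(x(1-y))` and `s = √(y(1-x))`, one has `x - y = p² - s²`, `p ≤ Λ s` and, by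
Cauchy–Schwarz, `p + s ≤ 1`. Hence `x - y ≤ p - s` and `(Λ + 1)(p - s) ≤ (Λ - 1)(p + s)`. -/
theorem sub_le_of_odds_le {Λ x y : ℝ} (hΛ : 1 ≤ Λ) (hx0 : 0 ≤ x) (hx1 : x ≤ 1) (hy0 : 0 ≤ y)
    (hy1 : y ≤ 1) (h : x * (1 - y) ≤ Λ ^ 2 * (y * (1 - x))) :
    (Λ + 1) * (x - y) ≤ Λ - 1 := by
  rcases le_total x y with hxy | hxy
  · nlinarith
  set p := √(x * (1 - y)) with hp
  set s := √(y * (1 - x)) with hs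
  have hp2 : p ^ 2 = x * (1 - y) := Real.sq_sqrt (mul_nonneg hx0 (by linarith))
  have hs2 : s ^ 2 = y * (1 - x) := Real.sq_sqrt (mul_nonneg hy0 (by linarith))
  have hp0 : 0 ≤ p := Real.sqrt_nonneg _
  have hs0 : 0 ≤ s := Real.sqrt_nonneg _
  have hps : p ≤ Λ * s := by
    refine (pow_le_pow_iff_left₀ hp0 (by positivity) two_ne_zero).mp ?_
    rw [mul_pow, hp2, hs2]; exact h
  have hsum : p + s ≤ 1 := by
    have h4 : (2 * (p * s)) ^ 2 ≤ (1 - p ^ 2 - s ^ 2) ^ 2 := by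
      have : (2 * (p * s)) ^ 2 = 4 * (p ^ 2 * s ^ 2) := by ring
      rw [this, hp2, hs2]
      nlinarith [sq_nonneg (1 - x - y)]
    have h5 : 0 ≤ 1 - p ^ 2 - s ^ 2 := by rw [hp2, hs2]; nlinarith
    have h6 := abs_le_of_sq_le_sq' h4 h5
    nlinarith [h6.2]
  have hd : x - y = (p - s) * (p + s) := by nlinarith
  have hsp : s ≤ p := by
    refine (pow_le_pow_iff_left₀ hs0 hp0 two_ne_zero).mp ?_
    rw [hp2, hs2]; linarith
  have h7 : x - y ≤ p - s := by rw [hd]; exact mul_le_of_le_one_right (by linarith) hsum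
  nlinarith

/-- The values of stopping two similar chains optimally cannot differ by much. -/
theorem IsStoppingValue.sub_le {K K' : ι → ι → ℝ} (hK : IsTransition K) (hK' : IsTransition K')
    {r : ℝ} (hr1 : 1 ≤ r) (hr : ∀ i j, K i j ≤ r * K' i j) (hr' : ∀ i j, K' i j ≤ r * K i j)
    {a v v' : ι → ℝ} (ha0 : ∀ i, 0 ≤ a i) (ha1 : ∀ i, a i ≤ 1) (hv : IsStoppingValue K a v)
    (hv' : IsStoppingValue K' a v') {n : ℕ} (hn : Fintype.card ι = n + 2) (i : ι) :
    (r ^ n + 1) * (v i - v' i) ≤ r ^ n - 1 := by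
  have hr0 : 0 ≤ r := zero_le_one.trans hr1
  have hΛ : 1 ≤ r ^ n := one_le_pow₀ hr1
  let D : Set ι := {i | v i = a i}
  have hD : MeetsClosed K D := hv.meetsClosed hK
  have hD' : MeetsClosed K' D := hD.mono fun i j h => by
    by_contra hn
    have := hr i j
    nlinarith
  -- `x'` is the payoff of the chain `K'` stopped in the set that is optimal for `K`; it cannot
  -- exceed the optimal value `v'`.
  obtain ⟨x', h0', h1'⟩ := exists_harmonic hK' hD' a
  have hx'v : x' i ≤ v' i := by
    have := minimum_principle hK' hD' (y := fun i => v' i - x' i)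
      (fun i hi => by rw [h0' i hi]; exact sub_nonneg.mpr (hv'.le i))
      (fun i hi => by
        simp only [mul_sub, Finset.sum_sub_distrib, ← h1' i hi]
        exact sub_le_sub_right (hv'.superharmonic i) _) i
    linarith
  have h1 : ∀ i ∉ D, v i = ∑ j, K i j * v j := fun i hi => hv.eq_sum_of_ne hK hi
  have hv0 : ∀ i, 0 ≤ v i := fun i => (ha0 i).trans (hv.le i)
  obtain ⟨d, -, hd⟩ := hD Set.univ ⟨i, trivial⟩ fun _ _ _ _ => trivial
  -- With a single stopping state both chains end in `d`, so `v i = x' i = a d`. Otherwise two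
  -- states are not transient, which gives the exponent `n`.
  by_cases hDd : D ⊆ {d}
  · have hconst : ∀ {L : ι → ι → ℝ}, IsTransition L → MeetsClosed L D → ∀ {y : ι → ℝ},
        (∀ i ∈ D, y i = a i) → (∀ i ∉ D, y i = ∑ j, L i j * y j) → y i = a d := by
      intro L hL hLD y hy0 hy1
      refine sub_eq_zero.mp (eq_zero_of_harmonic hL hLD (y := fun i => y i - a d)
        (fun i hi => ?_) (fun i hi => ?_) i)
      · rw [hy0 i hi, show i = d from hDd hi, sub_self]
      · simp only [mul_sub, Finset.sum_sub_distrib, ← Finset.sum_mul, hL.2, one_mul, ← hy1 i hi]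
    have e1 := hconst hK' hD' h0' h1'
    have e2 := hconst hK hD (fun _ h => h) h1
    nlinarith
  · have hcard : Dᶜ.ncard ≤ n := by
      obtain ⟨e, he, hed⟩ := Set.not_subset.mp hDd
      have h2 : 1 < D.ncard := (Set.one_lt_ncard (Set.toFinite D)).mpr
        ⟨e, he, d, hd, fun h => hed h⟩
      have := Set.ncard_add_ncard_compl D
      rw [Nat.card_eq_fintype_card, hn] at this
      omega
    have hx'0 : 0 ≤ x' i := minimum_principle hK' hD' (fun i hi => by rw [h0' i hi]; exact ha0 i)
      (fun i hi => (h1' i hi).ge) i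
    have hv1 : v i ≤ 1 := hv.le_one hK ha1 i
    have hodds := exit_odds_le hK hK' hD hD' hr0 hr hr' ha0 ha1 (fun _ h => h) h1 h0' h1' i
    have hpow : (r ^ Dᶜ.ncard) ^ 2 ≤ (r ^ n) ^ 2 :=
      pow_le_pow_left₀ (pow_nonneg hr0 _) (pow_le_pow_right₀ hr1 hcard) 2
    have hx'1 : x' i ≤ 1 := hx'v.trans (hv'.le_one hK' ha1 i)
    have := sub_le_of_odds_le hΛ (hv0 i) hv1 hx'0 hx'1
      (hodds.trans (mul_le_mul_of_nonneg_right hpow (mul_nonneg hx'0 (by linarith))))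
    nlinarith

end OptimalStopping

end Persuasion

/-! ### Best responses of the sender -/

namespace Persuasion

open Filter Topology

section BestResponse

variable {S : Type} {m : ℕ} [Fintype S]

/-- The transition probabilities between memory states in the state of nature `θ`, as long as the
sender does not stop. -/
def kernel (E : Environment S) (P : Protocol m S) (θ : Nature) (i j : Fin m) : ℝ :=
  ∑ s, E.signal θ s * (P.trans i s).1 j

theorem isTransition_kernel (E : Environment S) (P : Protocol m S) (θ : Nature) :
    IsTransition (kernel E P θ) := by
  refine ⟨fun i j => Finset.sum_nonneg fun s _ =>
    mul_nonneg (E.signal_pos θ s).le ((P.trans i s).2.1 j), fun i => ?_⟩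
  simp only [kernel]
  rw [Finset.sum_comm]
  simp only [← Finset.mul_sum]
  rw [← E.signal_sum θ]
  exact Finset.sum_congr rfl fun s _ => by rw [(P.trans i s).2.2, mul_one]

theorem sum_running_succ_mul (E : Environment S) (P : Protocol m S) (σ : Strategy m) (θ : Nature)
    (t : ℕ) (w : Fin m → ℝ) :
    ∑ j, running E P σ θ (t + 1) j * w j =
      ∑ i, running E P σ θ t i * ((1 - endProb P σ θ i) * ∑ j, kernel E P θ i j * w j) := by
  simp only [running, Finset.sum_mul, Finset.mul_sum]
  rw [Finset.sum_comm]
  refine Finset.sum_congr rfl fun i _ => Finset.sum_congr rfl fun j _ => ?_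
  simp only [kernel, ← Finset.mul_sum, ← Finset.sum_mul]
  ring

theorem hasSum_endsIn_mul (E : Environment S) (P : Protocol m S) (σ : Strategy m) (θ : Nature)
    (w : Fin m → ℝ) :
    HasSum (fun t => ∑ i, running E P σ θ t i * endProb P σ θ i * w i)
      (∑ i, endsIn E P σ θ i * w i) :=
  hasSum_sum fun i _ => (summable_endsIn E P σ θ i).hasSum.mul_right (w i)

/-- Stopping in the set `D θ` of memory states in the state of nature `θ`. -/
noncomputable def stopIn (D : Nature → Set (Fin m)) : Strategy m :=
  fun i θ => ⟨(D θ).indicator 1 i, by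
    by_cases h : i ∈ D θ <;> simp [h]⟩

theorem endProb_stopIn {S : Type} (P : Protocol m S) {D : Nature → Set (Fin m)}
    (hD : ∀ θ i, P.IsAbsorbing i → i ∈ D θ) (θ : Nature) (i : Fin m) :
    endProb P (stopIn D) θ i = (D θ).indicator 1 i := by
  unfold endProb
  split_ifs with h
  · rw [Set.indicator_of_mem (hD θ i h), Pi.one_apply]
  · rfl

theorem kernel_self_of_isAbsorbing (E : Environment S) (P : Protocol m S) (θ : Nature) {i : Fin m}
    (h : P.IsAbsorbing i) : kernel E P θ i i = 1 := by
  rw [kernel, ← E.signal_sum θ]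
  exact Finset.sum_congr rfl fun s _ => by rw [h s, mul_one]

theorem kernel_of_isAbsorbing (E : Environment S) (P : Protocol m S) (θ : Nature) {i j : Fin m}
    (h : P.IsAbsorbing i) (hij : j ≠ i) : kernel E P θ i j = 0 := by
  have hK := isTransition_kernel E P θ
  have h1 := hK.2 i
  rw [← Finset.add_sum_erase _ _ (Finset.mem_univ i), kernel_self_of_isAbsorbing E P θ h] at h1
  have h2 : ∑ j ∈ Finset.univ.erase i, kernel E P θ i j = 0 := by linarith
  exact (Finset.sum_eq_zero_iff_of_nonneg fun j _ => hK.1 i j).mp h2 j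
    (Finset.mem_erase.mpr ⟨hij, Finset.mem_univ j⟩)

theorem mem_of_isAbsorbing (E : Environment S) (P : Protocol m S) (θ : Nature) {D : Set (Fin m)}
    (hD : MeetsClosed (kernel E P θ) D) {i : Fin m} (h : P.IsAbsorbing i) : i ∈ D := by
  obtain ⟨j, hj, hjD⟩ := hD {i} ⟨i, rfl⟩ fun k hk j hj => by
    rw [Set.mem_singleton_iff] at hk ⊢
    subst hk
    by_contra hne
    exact hj.ne' (kernel_of_isAbsorbing E P θ h hne)
  rwa [Set.mem_singleton_iff.mp hj] at hjD

/-- The probability that the chain started in `i` has not ended after `n` periods. -/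
noncomputable def survival (E : Environment S) (P : Protocol m S) (σ : Strategy m) (θ : Nature) :
    ℕ → Fin m → ℝ
  | 0, _ => 1
  | n + 1, i => (1 - endProb P σ θ i) * ∑ j, kernel E P θ i j * survival E P σ θ n j

/-- The Markov property, linking the forward recursion of `running` to the backward recursion of
`survival`. -/
theorem sum_running_mul_survival (E : Environment S) (P : Protocol m S) (σ : Strategy m)
    (θ : Nature) (t k : ℕ) :
    ∑ i, running E P σ θ t i * survival E P σ θ k i =
      ∑ i, P.init.1 i * survival E P σ θ (t + k) i := by
  induction t generalizing k with
  | zero => simp [running]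
  | succ t ih =>
    rw [sum_running_succ_mul, show t + 1 + k = t + (k + 1) by ring, ← ih]
    rfl

theorem survival_nonneg (E : Environment S) (P : Protocol m S) (σ : Strategy m) (θ : Nature)
    (n : ℕ) (i : Fin m) : 0 ≤ survival E P σ θ n i := by
  induction n generalizing i with
  | zero => exact zero_le_one
  | succ n ih =>
    exact mul_nonneg (sub_nonneg.mpr (endProb_le_one P σ θ i)) (Finset.sum_nonneg fun j _ =>
      mul_nonneg ((isTransition_kernel E P θ).1 i j) (ih j))

theorem antitone_survival (E : Environment S) (P : Protocol m S) (σ : Strategy m) (θ : Nature)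
    (i : Fin m) : Antitone fun n => survival E P σ θ n i := by
  refine antitone_nat_of_succ_le fun n => ?_
  have hK := isTransition_kernel E P θ
  induction n generalizing i with
  | zero =>
    simp only [survival, mul_one, hK.2]
    linarith [endProb_nonneg P σ θ i]
  | succ n ih =>
    exact mul_le_mul_of_nonneg_left (Finset.sum_le_sum fun j _ =>
      mul_le_mul_of_nonneg_left (ih j) (hK.1 i j)) (sub_nonneg.mpr (endProb_le_one P σ θ i))

/-- The decreasing limit vanishes on `D` and is harmonic off `D`, hence is zero. -/
theorem tendsto_survival_zero (E : Environment S) (P : Protocol m S) {σ : Strategy m} {θ : Nature}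
    {D : Set (Fin m)} (hD : MeetsClosed (kernel E P θ) D)
    (hσ : ∀ i, endProb P σ θ i = D.indicator 1 i) (i : Fin m) :
    Tendsto (fun n => survival E P σ θ n i) atTop (𝓝 0) := by
  let e : Fin m → ℝ := fun i => ⨅ n, survival E P σ θ n i
  have he : ∀ i, Tendsto (fun n => survival E P σ θ n i) atTop (𝓝 (e i)) := fun i =>
    tendsto_atTop_ciInf (antitone_survival E P σ θ i)
      ⟨0, by rintro _ ⟨n, rfl⟩; exact survival_nonneg E P σ θ n i⟩
  have hrec : ∀ i, e i = (1 - endProb P σ θ i) * ∑ j, kernel E P θ i j * e j := fun i =>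
    tendsto_nhds_unique ((tendsto_add_atTop_iff_nat 1).mpr (he i))
      ((tendsto_finsetSum _ fun j _ => (he j).const_mul _).const_mul _)
  have hzero := eq_zero_of_harmonic (isTransition_kernel E P θ) hD (y := e)
    (fun i hi => by rw [hrec, hσ, Set.indicator_of_mem hi]; simp)
    (fun i hi => by
      have h := hrec i
      rwa [hσ, Set.indicator_of_notMem hi, sub_zero, one_mul] at h) i
  rw [← hzero]
  exact he i

theorem tendsto_sum_running_zero (E : Environment S) (P : Protocol m S) {σ : Strategy m}
    {θ : Nature} {D : Set (Fin m)} (hD : MeetsClosed (kernel E P θ) D)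
    (hσ : ∀ i, endProb P σ θ i = D.indicator 1 i) :
    Tendsto (fun n => ∑ i, running E P σ θ n i) atTop (𝓝 0) := by
  have h : ∀ n, ∑ i, running E P σ θ n i = ∑ i, P.init.1 i * survival E P σ θ n i := fun n => by
    simpa [survival] using sum_running_mul_survival E P σ θ n 0
  simp only [h]
  simpa using tendsto_finsetSum Finset.univ fun i _ =>
    (tendsto_survival_zero E P hD hσ i).const_mul (P.init.1 i)

theorem endsAlmostSurely_of_meetsClosed (E : Environment S) (P : Protocol m S) {σ : Strategy m}
    {D : Nature → Set (Fin m)} (hD : ∀ θ, MeetsClosed (kernel E P θ) (D θ))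
    (hσ : ∀ θ i, endProb P σ θ i = (D θ).indicator 1 i) : EndsAlmostSurely E P σ := by
  intro θ
  have h1 := (hasSum_endsIn_mul E P σ θ fun _ => 1).tendsto_sum_nat
  simp only [mul_one] at h1
  have h2 := h1.add (tendsto_sum_running_zero E P (hD θ) (hσ θ))
  simp only [sum_ended_add_running, add_zero] at h2
  exact tendsto_nhds_unique h2 tendsto_const_nhds

/-- The probability of the action `H` in the state of nature `θ`. -/
noncomputable def probH (E : Environment S) (P : Protocol m S) (σ : Strategy m) (θ : Nature) : ℝ :=
  ∑ i, endsIn E P σ θ i * (P.action i : ℝ)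

/-- No strategy makes the action `H` more likely than the value of optimal stopping. -/
theorem probH_le (E : Environment S) (P : Protocol m S) (σ : Strategy m) {θ : Nature}
    {v : Fin m → ℝ} (hv : IsStoppingValue (kernel E P θ) (fun i => P.action i) v) :
    probH E P σ θ ≤ ∑ i, P.init.1 i * v i := by
  have hv0 : ∀ i, 0 ≤ v i := fun i => (P.action i).2.1.trans (hv.le i)
  -- Payoff collected so far plus the value of the chain still running is nonincreasing in `n`.
  have hpart : ∀ n, (∑ t ∈ Finset.range n, ∑ i, running E P σ θ t i * endProb P σ θ i * P.action i)
      + ∑ i, running E P σ θ n i * v i ≤ ∑ i, P.init.1 i * v i := fun n => by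
    induction n with
    | zero => simp [running]
    | succ n ih =>
      refine le_trans ?_ ih
      rw [Finset.sum_range_succ, sum_running_succ_mul, add_assoc, ← Finset.sum_add_distrib]
      refine add_le_add_right (Finset.sum_le_sum fun i _ => ?_) _
      have h1 := mul_le_mul_of_nonneg_left (hv.le i) (endProb_nonneg P σ θ i)
      have h2 := mul_le_mul_of_nonneg_left (hv.superharmonic i)
        (sub_nonneg.mpr (endProb_le_one P σ θ i))
      calc _ = running E P σ θ n i * (endProb P σ θ i * P.action i +
            (1 - endProb P σ θ i) * ∑ j, kernel E P θ i j * v j) := by ring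
        _ ≤ running E P σ θ n i * v i :=
          mul_le_mul_of_nonneg_left (by linarith) (running_nonneg E P σ θ n i)
  refine le_of_tendsto' (hasSum_endsIn_mul E P σ θ _).tendsto_sum_nat fun n => ?_
  have := Finset.sum_nonneg fun i (_ : i ∈ Finset.univ) =>
    mul_nonneg (running_nonneg E P σ θ n i) (hv0 i)
  linarith [hpart n]

/-- Stopping where the value equals the probability of the action `H` is optimal. -/
theorem probH_eq (E : Environment S) (P : Protocol m S) {σ : Strategy m} {θ : Nature}
    {v : Fin m → ℝ} (hv : IsStoppingValue (kernel E P θ) (fun i => P.action i) v)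
    (hσ : ∀ i, endProb P σ θ i = {i | v i = P.action i}.indicator 1 i) :
    probH E P σ θ = ∑ i, P.init.1 i * v i := by
  have hK := isTransition_kernel E P θ
  have hv0 : ∀ i, 0 ≤ v i := fun i => (P.action i).2.1.trans (hv.le i)
  have hv1 : ∀ i, v i ≤ 1 := hv.le_one hK fun i => (P.action i).2.2
  have hpart : ∀ n, (∑ t ∈ Finset.range n, ∑ i, running E P σ θ t i * endProb P σ θ i * P.action i)
      + ∑ i, running E P σ θ n i * v i = ∑ i, P.init.1 i * v i := fun n => by
    induction n with
    | zero => simp [running]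
    | succ n ih =>
      rw [← ih, Finset.sum_range_succ, sum_running_succ_mul, add_assoc, ← Finset.sum_add_distrib]
      congr 1
      refine Finset.sum_congr rfl fun i _ => ?_
      rw [hσ]
      by_cases hi : v i = P.action i
      · rw [Set.indicator_of_mem (show i ∈ {i | v i = P.action i} from hi), Pi.one_apply, hi]
        ring
      -- Rewriting forth and back turns both `v i` and its one-step average into `v i`.
      · rw [Set.indicator_of_notMem (show i ∉ {i | v i = P.action i} from hi),
          hv.eq_sum_of_ne hK hi, ← hv.eq_sum_of_ne hK hi]
        ring
  have hrun : Tendsto (fun n => ∑ i, running E P σ θ n i * v i) atTop (𝓝 0) :=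
    squeeze_zero
      (fun n => Finset.sum_nonneg fun i _ => mul_nonneg (running_nonneg E P σ θ n i) (hv0 i))
      (fun n => Finset.sum_le_sum fun i _ =>
        mul_le_of_le_one_right (running_nonneg E P σ θ n i) (hv1 i))
      (tendsto_sum_running_zero E P (hv.meetsClosed hK) hσ)
  have h := (hasSum_endsIn_mul E P σ θ fun i => P.action i).tendsto_sum_nat.add hrun
  simp only [hpart, add_zero] at h
  exact tendsto_nhds_unique h tendsto_const_nhds

theorem exists_isStoppingValue_kernel (E : Environment S) (P : Protocol m S) (θ : Nature) :
    ∃ v, IsStoppingValue (kernel E P θ) (fun i => P.action i) v :=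
  exists_isStoppingValue (isTransition_kernel E P θ) fun i => (P.action i).2.2

/-- The receiver's value in terms of the sender's optimal stopping values. -/
theorem isReceiverValue_iff (E : Environment S) (P : Protocol m S) {v : Nature → Fin m → ℝ}
    (hv : ∀ θ, IsStoppingValue (kernel E P θ) (fun i => P.action i) (v θ)) (u : ℝ) :
    IsReceiverValue E P u ↔
      u = E.p * ∑ i, P.init.1 i * v Nature.H i + (1 - E.p) * (1 - ∑ i, P.init.1 i * v Nature.L i) := by
  let D : Nature → Set (Fin m) := fun θ => {i | v θ i = P.action i}
  have hD : ∀ θ, MeetsClosed (kernel E P θ) (D θ) := fun θ =>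
    (hv θ).meetsClosed (isTransition_kernel E P θ)
  have hend : ∀ θ i, endProb P (stopIn D) θ i = (D θ).indicator 1 i :=
    endProb_stopIn P fun θ i h => mem_of_isAbsorbing E P θ (hD θ) h
  have hopt : ∀ θ, probH E P (stopIn D) θ = ∑ i, P.init.1 i * v θ i := fun θ =>
    probH_eq E P (hv θ) (hend θ)
  have hsender : ∀ σ, senderPayoff E P σ =
      E.p * probH E P σ Nature.H + (1 - E.p) * probH E P σ Nature.L := fun _ => rfl
  have hreceiver : ∀ σ, EndsAlmostSurely E P σ → receiverPayoff E P σ =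
      E.p * probH E P σ Nature.H + (1 - E.p) * (1 - probH E P σ Nature.L) := fun σ hσ => by
    simp only [receiverPayoff, probH, mul_sub, mul_one, Finset.sum_sub_distrib, hσ Nature.L]
  have hp := E.p_pos
  have hp' := sub_pos.mpr E.p_lt_one
  constructor
  · rintro ⟨σ, hbest, hends, rfl⟩
    -- A best response attains the sum of the two upper bounds of `probH_le`, hence each of them
    -- separately.
    have h := hbest (stopIn D)
    rw [hsender, hsender, hopt, hopt] at h
    have hH := mul_le_mul_of_nonneg_left (probH_le E P σ (hv Nature.H)) hp.le
    have hL := mul_le_mul_of_nonneg_left (probH_le E P σ (hv Nature.L)) hp'.le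
    rw [hreceiver σ hends, mul_sub, mul_sub]
    linarith
  · rintro rfl
    have hends := endsAlmostSurely_of_meetsClosed E P hD hend
    refine ⟨stopIn D, fun σ => ?_, hends, ?_⟩
    · rw [hsender, hsender, hopt, hopt]
      exact add_le_add (mul_le_mul_of_nonneg_left (probH_le E P σ (hv Nature.H)) hp.le)
        (mul_le_mul_of_nonneg_left (probH_le E P σ (hv Nature.L)) hp'.le)
    · rw [hreceiver _ hends, hopt, hopt]

theorem existsUnique_isReceiverValue (E : Environment S) (P : Protocol m S) :
    ∃! u, IsReceiverValue E P u := by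
  choose v hv using exists_isStoppingValue_kernel E P
  exact ⟨_, (isReceiverValue_iff E P hv _).mpr rfl, fun u hu => (isReceiverValue_iff E P hv u).mp hu⟩

end BestResponse

/-! ### The upper bound -/

section UpperBound

variable {m : ℕ} {q : ℝ}

theorem kernel_symmetricBinary (hq : 1 / 2 < q) (hq' : q < 1) (P : Protocol m Signal) (θ : Nature)
    (i j : Fin m) : kernel (symmetricBinary q hq hq') P θ i j =
      symmetricSignal q θ Signal.h * (P.trans i Signal.h).1 j +
        symmetricSignal q θ Signal.l * (P.trans i Signal.l).1 j :=
  Signal.sum_univ _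

theorem isReceiverValue_le (hq : 1 / 2 < q) (hq' : q < 1) {n : ℕ} (P : Protocol (n + 2) Signal)
    {u : ℝ} (hu : IsReceiverValue (symmetricBinary q hq hq') P u) :
    u ≤ q ^ n / (q ^ n + (1 - q) ^ n) := by
  let E := symmetricBinary q hq hq'
  choose v hv using exists_isStoppingValue_kernel E P
  rw [isReceiverValue_iff E P hv, show E.p = 1 / 2 from rfl] at hu
  have hq0 : 0 < q := by linarith
  have hq1 : 0 < 1 - q := by linarith
  have hr1 : 1 ≤ q / (1 - q) := by rw [le_div_iff₀ hq1]; linarith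
  -- Signal probabilities are `q` or `1 - q`; these are the four possible comparisons between them.
  have e1 : q ≤ q / (1 - q) * q := le_mul_of_one_le_left hq0.le hr1
  have e2 : 1 - q ≤ q / (1 - q) * (1 - q) := le_mul_of_one_le_left hq1.le hr1
  have e3 : q = q / (1 - q) * (1 - q) := by field_simp
  have e4 : 1 - q ≤ q / (1 - q) * q := by linarith
  have hle : ∀ θ θ' i j, kernel E P θ i j ≤ q / (1 - q) * kernel E P θ' i j := by
    intro θ θ' i j
    have hh := (P.trans i Signal.h).2.1 j
    have hl := (P.trans i Signal.l).2.1 j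
    simp only [E, kernel_symmetricBinary, mul_add, ← mul_assoc]
    cases θ <;> cases θ' <;> simp only [symmetricSignal] <;>
      exact add_le_add (mul_le_mul_of_nonneg_right (by linarith) hh)
        (mul_le_mul_of_nonneg_right (by linarith) hl)
  have hdiff := IsStoppingValue.sub_le (isTransition_kernel E P Nature.H)
    (isTransition_kernel E P Nature.L) hr1 (hle _ _) (hle _ _) (fun i => (P.action i).2.1)
    (fun i => (P.action i).2.2) (hv Nature.H) (hv Nature.L) (Fintype.card_fin _)
  have hsum : ((q / (1 - q)) ^ n + 1) * (∑ i, P.init.1 i * v Nature.H i -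
      ∑ i, P.init.1 i * v Nature.L i) ≤ (q / (1 - q)) ^ n - 1 := by
    calc _ = ∑ i, P.init.1 i * (((q / (1 - q)) ^ n + 1) * (v Nature.H i - v Nature.L i)) := by
          rw [← Finset.sum_sub_distrib, Finset.mul_sum]
          exact Finset.sum_congr rfl fun i _ => by ring
      _ ≤ ∑ i, P.init.1 i * ((q / (1 - q)) ^ n - 1) :=
          Finset.sum_le_sum fun i _ => mul_le_mul_of_nonneg_left (hdiff i) (P.init.2.1 i)
      _ = _ := by rw [← Finset.sum_mul, P.init.2.2, one_mul]
  have hqn : 0 < q ^ n := pow_pos hq0 n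
  have hqn' : 0 < (1 - q) ^ n := pow_pos hq1 n
  have hpow : (q / (1 - q)) ^ n * (1 - q) ^ n = q ^ n := by
    rw [div_pow]; field_simp
  have h := mul_le_mul_of_nonneg_right hsum hqn'.le
  rw [mul_right_comm, add_mul, sub_mul, hpow, one_mul] at h
  rw [hu, le_div_iff₀ (by positivity)]
  linarith

end UpperBound

end Persuasion

/-! ### Protocols close to the upper bound -/

namespace Persuasion

open Filter Topology

section Walk

/-- Moving from `i` to `j` with probability `c`, and staying in `i` otherwise. -/
noncomputable def moveWithProb {m : ℕ} (c : unitInterval) (i j : Fin m) : stdSimplex ℝ (Fin m) :=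
  ⟨fun k => (1 - c) * (Pi.single i 1 : Fin m → ℝ) k + c * (Pi.single j 1 : Fin m → ℝ) k, by
    have hs : ∀ l k : Fin m, 0 ≤ (Pi.single l 1 : Fin m → ℝ) k := fun l k => by
      rw [Pi.single_apply]
      split_ifs <;> norm_num
    refine ⟨fun k => add_nonneg (mul_nonneg (sub_nonneg.mpr c.2.2) (hs i k))
      (mul_nonneg c.2.1 (hs j k)), ?_⟩
    · rw [Finset.sum_add_distrib, ← Finset.mul_sum, ← Finset.mul_sum, Finset.sum_pi_single',
        Finset.sum_pi_single']
      simp⟩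

theorem sum_moveWithProb_mul {m : ℕ} (c : unitInterval) (i j : Fin m) (w : Fin m → ℝ) :
    ∑ k, (moveWithProb c i j).1 k * w k = (1 - c) * w i + c * w j := by
  simp only [moveWithProb, add_mul, Finset.sum_add_distrib, mul_assoc, ← Finset.mul_sum,
    Pi.single_apply, ite_mul, one_mul, zero_mul, Finset.sum_ite_eq', Finset.mem_univ, if_true]

variable {n : ℕ}

/-- One step up, except in the two extreme states. -/
def stepUp (i : Fin (n + 2)) : Fin (n + 2) :=
  ⟨if 0 < i.1 ∧ i.1 < n + 1 then i + 1 else i, by split_ifs <;> omega⟩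

/-- One step down, except in the two extreme states. -/
def stepDown (i : Fin (n + 2)) : Fin (n + 2) :=
  ⟨if 0 < i.1 ∧ i.1 < n + 1 then i - 1 else i, by split_ifs <;> omega⟩

/-- The protocol that counts signals up and down between `1` and `n`, and only rarely, with
probability `δ`, moves on to one of the absorbing states `0` and `n + 1`. -/
noncomputable def walkProtocol (n : ℕ) (δ : unitInterval) : Protocol (n + 2) Signal where
  trans i
    | Signal.h => moveWithProb (if i.1 = n then δ else 1) i (stepUp i)
    | Signal.l => moveWithProb (if i.1 = 1 then δ else 1) i (stepDown i)
  init := moveWithProb 0 1 1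
  action i := if i.1 = n + 1 then 1 else 0

/-- The probability, up to a constant factor, that the walk started in `i` ends in `n + 1`, where
`μ` is the likelihood ratio of a step down and a step up. -/
def walkScale (n : ℕ) (δ μ : ℝ) (i : ℕ) : ℝ :=
  ∑ k ∈ Finset.range i, (if k = 0 ∨ k = n then 1 else δ) * μ ^ k

theorem walkScale_last (n : ℕ) (δ μ : ℝ) :
    walkScale (n + 1) δ μ (n + 2) = 1 + μ ^ (n + 1) + δ * ∑ k ∈ Finset.range n, μ ^ (k + 1) := by
  rw [walkScale, Finset.sum_range_succ, Finset.sum_range_succ', Finset.mul_sum,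
    Finset.sum_congr rfl fun k hk => by
      rw [if_neg (by have := Finset.mem_range.mp hk; omega : ¬ (k + 1 = 0 ∨ k + 1 = n + 1))]]
  simp
  ring

theorem walkScale_nonneg {δ μ : ℝ} (hδ : 0 ≤ δ) (hμ : 0 ≤ μ) (i : ℕ) : 0 ≤ walkScale n δ μ i :=
  Finset.sum_nonneg fun k _ => mul_nonneg (by split_ifs; exacts [zero_le_one, hδ]) (pow_nonneg hμ k)

variable {q : ℝ}

theorem sum_kernel_walkProtocol_mul (hq : 1 / 2 < q) (hq' : q < 1) (δ : unitInterval)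
    (θ : Nature) (i : Fin (n + 2)) (w : Fin (n + 2) → ℝ) :
    ∑ j, kernel (symmetricBinary q hq hq') (walkProtocol n δ) θ i j * w j =
      w i + symmetricSignal q θ Signal.h * (if i.1 = n then δ else 1 : unitInterval) *
          (w (stepUp i) - w i) -
        symmetricSignal q θ Signal.l * (if i.1 = 1 then δ else 1 : unitInterval) *
          (w i - w (stepDown i)) := by
  have hs : symmetricSignal q θ Signal.h + symmetricSignal q θ Signal.l = 1 := by
    cases θ <;> simp [symmetricSignal]
  simp only [kernel_symmetricBinary, add_mul, Finset.sum_add_distrib, mul_assoc, ← Finset.mul_sum,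
    walkProtocol, sum_moveWithProb_mul]
  linear_combination w i * hs

/-- At an interior state `i`, the up rate times the increment above and the down rate times the
increment below both equal `π_θ(h) * δ * μ ^ i`: the weights of `walkScale` are `1` exactly on the
two edges that are crossed with probability `δ`. -/
theorem walkScale_harmonic (hq : 1 / 2 < q) (hq' : q < 1) (δ : unitInterval) {θ : Nature} {μ : ℝ}
    (hμ : symmetricSignal q θ Signal.l = μ * symmetricSignal q θ Signal.h) (i : Fin (n + 2)) :
    ∑ j, kernel (symmetricBinary q hq hq') (walkProtocol n δ) θ i j * walkScale n δ μ j =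
      walkScale n δ μ i := by
  rw [sum_kernel_walkProtocol_mul hq hq' δ θ i fun j => walkScale n δ μ j]
  obtain ⟨i, hi⟩ := i
  by_cases hint : 0 < i ∧ i < n + 1
  · obtain ⟨k, rfl⟩ := Nat.exists_eq_succ_of_ne_zero hint.1.ne'
    simp only [stepUp, stepDown, if_pos hint, Nat.succ_eq_add_one, Nat.add_sub_cancel]
    have h1 : walkScale n δ μ (k + 1 + 1) - walkScale n δ μ (k + 1) =
        (if k + 1 = 0 ∨ k + 1 = n then 1 else (δ : ℝ)) * μ ^ (k + 1) := by
      rw [walkScale, Finset.sum_range_succ, walkScale, add_sub_cancel_left]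
    have h2 : walkScale n δ μ (k + 1) - walkScale n δ μ k =
        (if k = 0 ∨ k = n then 1 else (δ : ℝ)) * μ ^ k := by
      rw [walkScale, Finset.sum_range_succ, walkScale, add_sub_cancel_left]
    have h3 : ((if k + 1 = n then δ else 1 : unitInterval) : ℝ) *
        (if k + 1 = 0 ∨ k + 1 = n then 1 else (δ : ℝ)) = δ := by
      by_cases h : k + 1 = n <;> simp [h]
    have h4 : ((if k + 1 = 1 then δ else 1 : unitInterval) : ℝ) *
        (if k = 0 ∨ k = n then 1 else (δ : ℝ)) = δ := by
      have hk : k ≠ n := by omega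
      by_cases h : k = 0 <;> simp [h, hk]
    rw [h1, h2, hμ]
    linear_combination symmetricSignal q θ Signal.h * μ ^ (k + 1) * h3 -
      symmetricSignal q θ Signal.h * μ ^ (k + 1) * h4
  · simp only [stepUp, stepDown, if_neg hint, sub_self, mul_zero, add_zero, sub_zero]

/-- From an interior state the walk steps up with positive probability, so the largest element of a
closed set is an end state. -/
theorem meetsClosed_walkProtocol (hq : 1 / 2 < q) (hq' : q < 1) {δ : unitInterval} (hδ : 0 < δ)
    (θ : Nature) : MeetsClosed (kernel (symmetricBinary q hq hq') (walkProtocol n δ) θ)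
      {i | i.1 = 0 ∨ i.1 = n + 1} := by
  intro C hC hcl
  obtain ⟨i, hi, hmax⟩ := Set.exists_max_image C id (Set.toFinite C) hC
  refine ⟨i, hi, ?_⟩
  by_contra hD
  have hint : 0 < i.1 ∧ i.1 < n + 1 := by
    have := i.2
    have h0 : i.1 ≠ 0 := fun h => hD (Or.inl h)
    have h1 : i.1 ≠ n + 1 := fun h => hD (Or.inr h)
    omega
  have hup : (stepUp i).1 = i.1 + 1 := by simp [stepUp, hint]
  have hmem : stepUp i ∈ C := by
    refine hcl i hi _ ?_
    rw [kernel_symmetricBinary]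
    have hs := (symmetricBinary q hq hq').signal_pos θ
    refine add_pos_of_pos_of_nonneg (mul_pos (hs Signal.h) ?_)
      (mul_nonneg (hs Signal.l).le (((walkProtocol n δ).trans i Signal.l).2.1 _))
    have hne : stepUp i ≠ i := fun h => by
      have := congrArg Fin.val h
      omega
    simp only [walkProtocol, moveWithProb, Pi.single_eq_of_ne hne, Pi.single_eq_same, mul_zero,
      zero_add, mul_one]
    split_ifs
    · exact hδ
    · exact zero_lt_one
  have := Fin.le_def.mp (hmax _ hmem)
  simp only [id] at this
  omega

/-- A lower bound on the receiver's value of the protocol `walkProtocol`. -/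
theorem exists_isReceiverValue_walkProtocol_ge (hq : 1 / 2 < q) (hq' : q < 1) (n : ℕ)
    {δ : unitInterval} (hδ : 0 < δ) :
    ∃ u, IsReceiverValue (symmetricBinary q hq hq') (walkProtocol (n + 1) δ) u ∧
      1 / 2 * (1 / walkScale (n + 1) δ ((1 - q) / q) (n + 2)) +
        1 / 2 * (1 - 1 / walkScale (n + 1) δ (q / (1 - q)) (n + 2)) ≤ u := by
  let E := symmetricBinary q hq hq'
  let P := walkProtocol (n + 1) δ
  have hδ0 : (0 : ℝ) ≤ δ := δ.2.1
  have hq0 : 0 < q := by linarith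
  have hq1 : 0 < 1 - q := by linarith
  have hpos : ∀ {μ : ℝ}, 0 ≤ μ → 0 < walkScale (n + 1) δ μ (n + 2) := fun {μ} hμ => by
    rw [walkScale_last]
    have : 0 ≤ ∑ k ∈ Finset.range n, μ ^ (k + 1) := Finset.sum_nonneg fun k _ => pow_nonneg hμ _
    positivity
  have hone : ∀ μ, walkScale (n + 1) δ μ 1 = 1 := fun μ => by simp [walkScale]
  have hharm : ∀ {θ μ}, symmetricSignal q θ Signal.l = μ * symmetricSignal q θ Signal.h →
      ∀ i : Fin (n + 3), ∑ j, kernel E P θ i j *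
        (walkScale (n + 1) δ μ j / walkScale (n + 1) δ μ (n + 2)) =
        walkScale (n + 1) δ μ i / walkScale (n + 1) δ μ (n + 2) := fun {θ μ} hμ i => by
    simp only [← mul_div_assoc, ← Finset.sum_div]
    rw [walkScale_harmonic hq hq' δ hμ]
  choose v hv using exists_isStoppingValue_kernel E P
  have hinit : ∀ w : Fin (n + 3) → ℝ, ∑ i, P.init.1 i * w i = w 1 := fun w => by
    simp only [P, walkProtocol, sum_moveWithProb_mul]
    simp
  refine ⟨_, (isReceiverValue_iff E P hv _).mpr rfl, ?_⟩
  rw [hinit, hinit, show E.p = 1 / 2 from rfl]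
  -- The sender can let the walk run to the end, so the value is at least the harmonic function with
  -- boundary values `0` and `1`.
  have hH : 1 / walkScale (n + 1) δ ((1 - q) / q) (n + 2) ≤ v Nature.H 1 := by
    have hμ : 0 ≤ (1 - q) / q := by positivity
    have h := minimum_principle (isTransition_kernel E P Nature.H)
      (meetsClosed_walkProtocol hq hq' hδ Nature.H) (y := fun i => v Nature.H i -
        walkScale (n + 1) δ ((1 - q) / q) i / walkScale (n + 1) δ ((1 - q) / q) (n + 2))
      (fun i hi => ?_) (fun i _ => ?_) 1
    · simpa [hone] using h
    · have ha := (hv Nature.H).le i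
      rcases hi with hi | hi
      · rw [hi]
        simpa [walkScale] using (P.action i).2.1.trans ha
      · rw [hi, div_self (hpos hμ).ne']
        simpa [P, walkProtocol, hi] using ha
    · simp only [mul_sub, Finset.sum_sub_distrib]
      rw [hharm (by simp only [symmetricSignal]; field_simp)]
      exact sub_le_sub_right ((hv Nature.H).superharmonic i) _
  -- The harmonic function majorizes the action rule, which is zero below the top state: stopping
  -- early gains nothing.
  have hL : v Nature.L 1 ≤ 1 / walkScale (n + 1) δ (q / (1 - q)) (n + 2) := by
    have hμ : 0 ≤ q / (1 - q) := by positivity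
    have h := (hv Nature.L).least (fun i =>
        walkScale (n + 1) δ (q / (1 - q)) i / walkScale (n + 1) δ (q / (1 - q)) (n + 2))
      (fun i => ?_) (fun i => (hharm (by simp only [symmetricSignal]; field_simp) i).le) 1
    · simpa [hone] using h
    · by_cases hi : i.1 = n + 2
      · simp only [hi, div_self (hpos hμ).ne']
        exact (P.action i).2.2
      · simpa [P, walkProtocol, hi] using
          div_nonneg (walkScale_nonneg hδ0 hμ i) (hpos hμ).le
  linarith

/-- As `δ → 0` only the two extreme terms of `walkScale` survive, and the probability of action `H`
in either state bounds to `1 / (1 + μ ^ (n + 1))`. The two values of `μ` are reciprocal, so both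
states contribute equally. -/
theorem le_of_forall_isReceiverValue_le (hq : 1 / 2 < q) (hq' : q < 1) (n : ℕ) {b : ℝ}
    (hb : ∀ P : Protocol (n + 3) Signal, ∀ u, IsReceiverValue (symmetricBinary q hq hq') P u →
      u ≤ b) : q ^ (n + 1) / (q ^ (n + 1) + (1 - q) ^ (n + 1)) ≤ b := by
  have hq0 : 0 < q := by linarith
  have hq1 : 0 < 1 - q := by linarith
  have hlim : ∀ {μ : ℝ}, 0 ≤ μ → Tendsto (fun δ : ℝ => 1 / walkScale (n + 1) δ μ (n + 2))
      (𝓝[>] 0) (𝓝 (1 / (1 + μ ^ (n + 1)))) := fun {μ} hμ => by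
    have hcont : ContinuousAt (fun δ : ℝ => 1 / walkScale (n + 1) δ μ (n + 2)) 0 := by
      simp only [walkScale_last]
      refine ContinuousAt.div (by fun_prop) (by fun_prop) ?_
      positivity
    have h := hcont.tendsto.mono_left (nhdsWithin_le_nhds (s := Set.Ioi 0))
    simpa [walkScale_last] using h
  have h := ((hlim (μ := (1 - q) / q) (by positivity)).const_mul (1 / 2)).add
    (((hlim (μ := q / (1 - q)) (by positivity)).const_sub 1).const_mul (1 / 2))
  refine le_trans (le_of_eq ?_) (le_of_tendsto h ?_)
  · have := pow_pos hq0 (n + 1)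
    have := pow_pos hq1 (n + 1)
    rw [div_pow, div_pow]
    field_simp
    ring
  · filter_upwards [Ioo_mem_nhdsGT (zero_lt_one (α := ℝ))] with δ hδ
    obtain ⟨u, hu, hle⟩ := exists_isReceiverValue_walkProtocol_ge hq hq' n
      (δ := ⟨δ, hδ.1.le, hδ.2.le⟩) hδ.1
    exact hle.trans (hb _ u hu)

end Walk

end Persuasion

theorem mainTheorem7 (m : ℕ) (hm : 2 < m) (q : ℝ) (hq : 1 / 2 < q) (hq' : q < 1) :
    (∀ P : Persuasion.Protocol m Persuasion.Signal,
      ∃! u : ℝ, Persuasion.IsReceiverValue (Persuasion.symmetricBinary q hq hq') P u) ∧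
    IsLUB {u : ℝ | ∃ P : Persuasion.Protocol m Persuasion.Signal,
        Persuasion.IsReceiverValue (Persuasion.symmetricBinary q hq hq') P u}
      (q ^ (m - 2) / (q ^ (m - 2) + (1 - q) ^ (m - 2))) := by
  obtain ⟨n, rfl⟩ : ∃ n, m = n + 3 := ⟨m - 3, by omega⟩
  refine ⟨Persuasion.existsUnique_isReceiverValue _, ?_, fun b hb => ?_⟩
  · rintro u ⟨P, hu⟩
    exact Persuasion.isReceiverValue_le hq hq' (n := n + 1) P hu
  · exact Persuasion.le_of_forall_isReceiverValue_le hq hq' n fun P u hu => hb ⟨P, hu⟩
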